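/- Let $a,b>0$ be real numbers and let $$\Phi_{a,b}(z)={}_1F_1(a;a+b;z)=\sum_{k=0}^{\infty}\frac{(a)_k}{(a+b)_k}\,\frac{z^k}{k!},\qquad z\in\mathbb{C},$$ where $(x)_k=x(x+1)\cdots(x+k-1)$. Let $\{z_{a,b;k}\}_{k\ge 1}$ be the complex zeros of $\Phi_{a,b}$, repeated according to multiplicity, and define the hypergeometric zeta function by $$\zeta^H_{a,b}(s)=\sum_{k\ge 1}\frac{1}{z_{a,b;k}^{\,s}},\qquad \operatorname{Re}s>1,$$ with powers taken with the principal branch of the logarithm. Then this series converges absolutely for $\operatorname{Re}s>1$, the zeros satisfy $|z_{a,b;k}|\ge r$ for some $r>0$ and all $k$, and for every $z\in\mathbb{C}$ with $|z|<|z_{a,b;k}|$ for all $k$ the following power series converges absolutely and $$\frac{\Phi_{a,b+1}(z)}{\Phi_{a,b}(z)}=1+\frac{a+b}{b}\sum_{k=1}^{\infty}\zeta^H_{a,b}(k+1)\,z^k .$$ -/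

import Mathlib

/-- The Kummer function `M(a, c; z) = ∑_{k ≥ 0} (a)_k / (c)_k * z ^ k / k!`
(for `c` not a non-positive integer), where `(a)_k` is the rising factorial. -/
noncomputable def kummerM (a c z : ℂ) : ℂ :=
  ∑' k : ℕ, (ascPochhammer ℂ k).eval a / (ascPochhammer ℂ k).eval c * (z ^ k / (k.factorial : ℂ))

/-- `Φ_{a,b}(z) = M(a, a + b; z)`. -/
noncomputable def kummerPhi (a b : ℝ) (z : ℂ) : ℂ :=
  kummerM (a : ℂ) ((a : ℂ) + (b : ℂ)) z

/-- The set of complex zeros of `Φ_{a,b}`. -/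
def kummerZeros (a b : ℝ) : Set ℂ :=
  {w : ℂ | kummerPhi a b w = 0}

/-- The contribution of the zero `w` to the hypergeometric zeta function at `s`:
the term `1 / w ^ s`, repeated according to the multiplicity of `w` as a zero of `Φ_{a,b}`.
The power is taken with the principal branch of the logarithm. -/
noncomputable def hypergeometricZetaTerm (a b : ℝ) (s : ℂ) (w : kummerZeros a b) : ℂ :=
  (analyticOrderNatAt (kummerPhi a b) (w : ℂ) : ℂ) * (1 / (w : ℂ) ^ s)

/-- The hypergeometric zeta function `ζ^H_{a,b}(s)`, the sum of `1 / w ^ s` over the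
complex zeros `w` of `Φ_{a,b}`, repeated according to multiplicity. -/
noncomputable def hypergeometricZeta (a b : ℝ) (s : ℂ) : ℂ :=
  ∑' w : kummerZeros a b, hypergeometricZetaTerm a b s w

/-!
Write `f = Φ_{a,b}`. The coefficients `(a)_k / (a + b)_k` lie in `(0, 1]`, so `f` is entire with
`f 0 = 1` and `‖f z‖ ≤ exp ‖z‖`, and comparing coefficients gives the contiguous relation
`f' = f - b / (a + b) * Φ_{a,b+1}` (`hasDerivAt_kummerPhi`). Hence
`Φ_{a,b+1} / f = (a + b) / b * (1 - f' / f)`, and everything reduces to the Taylor expansion of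
`f' / f` at the origin, which holds for every entire `f` of exponential type with `f 0 = 1`.

The zeros of norm at most `R` are divided out: `f z = (∏ (1 - z / w) ^ m w) * g z`, where `m w` is
the multiplicity of `w` and `g` is entire. On the circle of radius `(1 + q) R` each factor
`1 - z / w` has norm at least `q`, so the maximum principle bounds `g` on the disc
(`norm_quotient_mul_pow_le`). This is used twice.

* With `q = e`, evaluation at `z = 0` shows that there are at most `4 A R` zeros of norm at most
  `R`, counted with multiplicity (`sum_analyticOrderNatAt_le`). It follows that no zero has norm
  less than `1 / (4 A)`, that the zeros are locally finite, and, by splitting into dyadic shells,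
  that `∑ m w * ‖w‖ ^ (-σ)` converges for `σ > 1`.
* With `q = 1`, `‖g‖ ≤ exp (2 A R)` on the disc of radius `R`, where `g` has no zeros. The
  Borel–Carathéodory theorem for `log g` together with Cauchy's estimates shows that the `k`-th
  Taylor coefficient of `g' / g` is `O(R ^ (-k))`. For `k ≥ 1` it tends to zero as `R → ∞`, so the
  `k`-th Taylor coefficient of `f' / f` is `-∑ m w / w ^ (k + 1)` (`hasSum_one_div_pow_zeros`).

The constant term of `f' / f` is `f' 0 = a / (a + b)`, which accounts for the summand `1` in the
expansion. This argument proves the part of Hadamard's factorization theorem that is needed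
without constructing the canonical product.
-/

/-! ### Dividing out zeros and counting them -/

theorem exists_differentiable_eq_sub_pow_mul {f : ℂ → ℂ} (hf : Differentiable ℂ f) {w : ℂ}
    (hw : analyticOrderAt f w ≠ ⊤) :
    ∃ g : ℂ → ℂ, Differentiable ℂ g ∧ g w ≠ 0 ∧
      ∀ z, f z = (z - w) ^ analyticOrderNatAt f w * g z := by
  obtain ⟨g, hg, hgw, hfg⟩ := ((hf.analyticAt w).analyticOrderAt_ne_top).1 hw
  set n := analyticOrderNatAt f w
  -- The global quotient, with the value at `w` supplied by the local factor.
  set G : ℂ → ℂ := fun z => if z = w then g w else f z / (z - w) ^ n with hG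
  have hGw : G w = g w := by simp [hG]
  have hGne : ∀ z, z ≠ w → G z = f z / (z - w) ^ n := fun z hz => by simp [hG, hz]
  have hGg : G =ᶠ[nhds w] g := by
    filter_upwards [hfg] with z hz
    by_cases h : z = w
    · rw [h, hGw]
    · rw [hGne z h, hz, smul_eq_mul, mul_div_cancel_left₀ _ (pow_ne_zero _ (sub_ne_zero.2 h))]
  refine ⟨G, fun z => ?_, by rwa [hGw], fun z => ?_⟩
  · by_cases h : z = w
    · rw [h]
      exact hGg.symm.differentiableAt_iff.1 hg.differentiableAt
    · have : G =ᶠ[nhds z] fun z => f z / (z - w) ^ n := by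
        filter_upwards [isOpen_ne.mem_nhds h] with y hy using hGne y hy
      refine this.symm.differentiableAt_iff.1 ?_
      exact (hf z).div (by fun_prop) (pow_ne_zero _ (sub_ne_zero.2 h))
  · by_cases h : z = w
    · rw [h, hGw]
      exact hfg.self_of_nhds
    · rw [hGne z h, mul_div_cancel₀ _ (pow_ne_zero _ (sub_ne_zero.2 h))]

theorem analyticOrderAt_ne_top_of_apply_ne_zero {f : ℂ → ℂ} (hf : Differentiable ℂ f) {x : ℂ}
    (hx : f x ≠ 0) (w : ℂ) : analyticOrderAt f w ≠ ⊤ := fun h =>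
  hx (congrFun ((AnalyticOnNhd.analyticOrderAt_eq_top_iff_eq_zero w fun z => hf.analyticAt z).1 h) x)

theorem one_le_analyticOrderNatAt {f : ℂ → ℂ} (hf : Differentiable ℂ f) {x : ℂ}
    (hx : f x ≠ 0) {w : ℂ} (hw : f w = 0) : 1 ≤ analyticOrderNatAt f w := by
  have h := (hf.analyticAt w).analyticOrderAt_ne_zero.2 hw
  rw [← Nat.cast_analyticOrderNatAt (analyticOrderAt_ne_top_of_apply_ne_zero hf hx w)] at h
  exact Nat.one_le_iff_ne_zero.2 (by exact_mod_cast h)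

theorem exists_differentiable_eq_prod_mul {f : ℂ → ℂ} (hf : Differentiable ℂ f) (h0 : f 0 ≠ 0)
    (S : Finset ℂ) (hS : ∀ w ∈ S, w ≠ 0) :
    ∃ g : ℂ → ℂ, Differentiable ℂ g ∧ (∀ w ∈ S, g w ≠ 0) ∧
      ∀ z, f z = (∏ w ∈ S, (1 - z / w) ^ analyticOrderNatAt f w) * g z := by
  induction S using Finset.induction_on with
  | empty => exact ⟨f, hf, by simp, by simp⟩
  | insert w S hwS ih =>
    obtain ⟨g, hg, hgS, hfg⟩ := ih fun v hv => hS v (Finset.mem_insert_of_mem hv)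
    have hw0 : w ≠ 0 := hS w (Finset.mem_insert_self w S)
    set P : ℂ → ℂ := fun z => ∏ v ∈ S, (1 - z / v) ^ analyticOrderNatAt f v with hP
    have hPd : Differentiable ℂ P := by rw [hP]; fun_prop
    have hPw : P w ≠ 0 := Finset.prod_ne_zero_iff.2 fun v hv => pow_ne_zero _ <| by
      have hv0 : v ≠ 0 := hS v (Finset.mem_insert_of_mem hv)
      rw [sub_ne_zero, ne_comm, Ne, div_eq_one_iff_eq hv0]
      rintro rfl
      exact hwS hv
    have hg0 : g 0 ≠ 0 := fun h => h0 (by rw [hfg, h, mul_zero])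
    -- The factors already removed do not vanish at `w`, so `g` keeps the order of `f` there.
    have hord : analyticOrderNatAt f w = analyticOrderNatAt g w := by
      have hfPg : f = P * g := funext hfg
      have hP0 : P 0 ≠ 0 := by simp [hP]
      conv_lhs => rw [hfPg]
      rw [analyticOrderNatAt_mul (hPd.analyticAt w) (hg.analyticAt w)
        (analyticOrderAt_ne_top_of_apply_ne_zero hPd hP0 w)
        (analyticOrderAt_ne_top_of_apply_ne_zero hg hg0 w)]
      have : analyticOrderAt P w = 0 := (hPd.analyticAt w).analyticOrderAt_eq_zero.2 hPw
      simp [analyticOrderNatAt, this]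
    obtain ⟨h, hh, hhw, hgh⟩ := exists_differentiable_eq_sub_pow_mul hg
      (analyticOrderAt_ne_top_of_apply_ne_zero hg hg0 w)
    rw [← hord] at hgh
    set m := analyticOrderNatAt f w
    refine ⟨fun z => (-w) ^ m * h z, by fun_prop, fun v hv => ?_, fun z => ?_⟩
    · refine mul_ne_zero (pow_ne_zero _ (neg_ne_zero.2 hw0)) ?_
      rcases Finset.mem_insert.1 hv with rfl | hv
      · exact hhw
      · exact fun h => hgS v hv (by rw [hgh, h, mul_zero])
    · rw [Finset.prod_insert hwS, hfg z, hgh z]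
      have : z - w = (1 - z / w) * (-w) := by field_simp; ring
      rw [this, mul_pow]
      ring

/-- On the circle of radius `(1 + q) R` each factor `1 - z / w` with `‖w‖ ≤ R` has norm at least
`q`, and the maximum principle carries the resulting bound on the quotient to the whole disc. -/
theorem norm_quotient_mul_pow_le {f g : ℂ → ℂ} {A q R : ℝ} (hg : Differentiable ℂ g)
    (hb : ∀ z, ‖f z‖ ≤ Real.exp (A * ‖z‖)) (hq : 0 < q) (hR : 0 < R)
    {S : Finset ℂ} (hS : ∀ w ∈ S, w ≠ 0) (hSR : ∀ w ∈ S, ‖w‖ ≤ R) {m : ℂ → ℕ}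
    (hfg : ∀ z, f z = (∏ w ∈ S, (1 - z / w) ^ m w) * g z)
    {z : ℂ} (hz : ‖z‖ ≤ (1 + q) * R) :
    ‖g z‖ * q ^ (∑ w ∈ S, m w) ≤ Real.exp (A * ((1 + q) * R)) := by
  have hρ : 0 < (1 + q) * R := by positivity
  rw [← le_div_iff₀ (by positivity)]
  refine Complex.norm_le_of_forall_mem_frontier_norm_le (U := Metric.ball 0 ((1 + q) * R))
    Metric.isBounded_ball hg.diffContOnCl (fun y hy => ?_) ?_
  · rw [frontier_ball _ hρ.ne', mem_sphere_zero_iff_norm] at hy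
    rw [le_div_iff₀ (by positivity)]
    have h1 : q ^ (∑ w ∈ S, m w) ≤ ‖∏ w ∈ S, (1 - y / w) ^ m w‖ := by
      rw [norm_prod, ← Finset.prod_pow_eq_pow_sum]
      refine Finset.prod_le_prod (fun _ _ => by positivity) fun w hw => ?_
      rw [norm_pow]
      refine pow_le_pow_left₀ hq.le ?_ _
      have hw0 : 0 < ‖w‖ := norm_pos_iff.2 (hS w hw)
      have h2 : 1 + q ≤ ‖y / w‖ := by
        rw [norm_div, hy, le_div_iff₀ hw0]
        exact mul_le_mul_of_nonneg_left (hSR w hw) (by positivity)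
      have h3 := norm_sub_norm_le (y / w) 1
      rw [norm_one, norm_sub_rev] at h3
      linarith
    calc ‖g y‖ * q ^ (∑ w ∈ S, m w) ≤ ‖g y‖ * ‖∏ w ∈ S, (1 - y / w) ^ m w‖ := by gcongr
      _ = ‖f y‖ := by rw [hfg y, norm_mul, mul_comm]
      _ ≤ _ := by simpa [hy] using hb y
  · rw [closure_ball _ hρ.ne']
    simpa using hz

/-- Linear growth of the number of zeros, counted with multiplicity; a substitute for Jensen's
formula with a cruder constant. -/
theorem sum_analyticOrderNatAt_le {f : ℂ → ℂ} {A R : ℝ} (hf : Differentiable ℂ f)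
    (h0 : f 0 = 1) (hA : 0 < A) (hb : ∀ z, ‖f z‖ ≤ Real.exp (A * ‖z‖)) (hR : 0 < R)
    (S : Finset ℂ) (hS : ∀ w ∈ S, f w = 0) (hSR : ∀ w ∈ S, ‖w‖ ≤ R) :
    ∑ w ∈ S, (analyticOrderNatAt f w : ℝ) ≤ 4 * A * R := by
  have hS0 : ∀ w ∈ S, w ≠ 0 := by
    rintro w hw rfl
    simpa [h0] using hS 0 hw
  obtain ⟨g, hg, -, hfg⟩ := exists_differentiable_eq_prod_mul hf (by simp [h0]) S hS0
  have hg0 : g 0 = 1 := by simpa [h0] using (hfg 0).symm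
  -- With `q = e` the bound at the origin reads `exp N ≤ exp (A (1 + e) R)`, `N` the zero count.
  have h := norm_quotient_mul_pow_le hg hb (Real.exp_pos 1) hR hS0 hSR hfg (z := 0)
    (by rw [norm_zero]; positivity)
  rw [hg0, norm_one, one_mul, ← Real.exp_nat_mul, Real.exp_le_exp, mul_one] at h
  push_cast at h
  refine h.trans ?_
  have h3 : 1 + Real.exp 1 ≤ 4 := by linarith [Real.exp_one_lt_d9]
  calc A * ((1 + Real.exp 1) * R) ≤ A * (4 * R) := by gcongr
    _ = _ := by ring

theorem inv_le_norm_of_apply_eq_zero {f : ℂ → ℂ} {A : ℝ} (hf : Differentiable ℂ f)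
    (h0 : f 0 = 1) (hA : 0 < A) (hb : ∀ z, ‖f z‖ ≤ Real.exp (A * ‖z‖)) {w : ℂ} (hw : f w = 0) :
    (4 * A)⁻¹ ≤ ‖w‖ := by
  have hw0 : w ≠ 0 := by
    rintro rfl
    simp [h0] at hw
  have h := sum_analyticOrderNatAt_le hf h0 hA hb (norm_pos_iff.2 hw0) {w} (by simpa) (by simp)
  have h1 : (1 : ℝ) ≤ analyticOrderNatAt f w := by
    exact_mod_cast one_le_analyticOrderNatAt hf (x := 0) (by simp [h0]) hw
  rw [Finset.sum_singleton] at h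
  rw [inv_le_iff_one_le_mul₀' (by positivity)]
  linarith

/-- Every zero counts at least once in `sum_analyticOrderNatAt_le`, so `4 * A * R` bounds the
cardinality of each finite set of zeros of norm at most `R`. -/
theorem finite_zeros_norm_le {f : ℂ → ℂ} {A : ℝ} (hf : Differentiable ℂ f)
    (h0 : f 0 = 1) (hA : 0 < A) (hb : ∀ z, ‖f z‖ ≤ Real.exp (A * ‖z‖)) (R : ℝ) :
    {w : ℂ | f w = 0 ∧ ‖w‖ ≤ R}.Finite := by
  by_contra hinf
  obtain ⟨w, hw⟩ := Set.Infinite.nonempty hinf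
  have hR : 0 < R := lt_of_lt_of_le (by positivity)
    ((inv_le_norm_of_apply_eq_zero hf h0 hA hb hw.1).trans hw.2)
  obtain ⟨n, hn⟩ := exists_nat_gt (4 * A * R)
  obtain ⟨S, hS, hcard⟩ := Set.Infinite.exists_subset_card_eq hinf n
  have h := sum_analyticOrderNatAt_le hf h0 hA hb hR S (fun w hw => (hS hw).1)
    fun w hw => (hS hw).2
  have h1 : ∑ w ∈ S, (1 : ℝ) ≤ ∑ w ∈ S, (analyticOrderNatAt f w : ℝ) :=
    Finset.sum_le_sum fun w hw => by
      exact_mod_cast one_le_analyticOrderNatAt hf (x := 0) (by simp [h0]) (hS hw).1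
  simp only [Finset.sum_const, hcard, nsmul_eq_mul, mul_one] at h1
  linarith

/-- Linear growth of the number of zeros bounds the sum over a dyadic shell of radius `r * 2 ^ j`
by a constant times `(2 ^ (1 - σ)) ^ j`, a convergent geometric series. -/
theorem summable_analyticOrderNatAt_mul_norm_rpow {f : ℂ → ℂ} {A : ℝ} (hf : Differentiable ℂ f)
    (h0 : f 0 = 1) (hA : 0 < A) (hb : ∀ z, ‖f z‖ ≤ Real.exp (A * ‖z‖)) {σ : ℝ} (hσ : 1 < σ) :
    Summable fun w : {w : ℂ | f w = 0} => (analyticOrderNatAt f w : ℝ) * ‖(w : ℂ)‖ ^ (-σ) := by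
  set r : ℝ := (4 * A)⁻¹ with hr
  have hr0 : 0 < r := by positivity
  have hrw : ∀ w : {w : ℂ | f w = 0}, r ≤ ‖(w : ℂ)‖ := fun w =>
    inv_le_norm_of_apply_eq_zero hf h0 hA hb w.2
  have hex : ∀ w : {w : ℂ | f w = 0}, ∃ n : ℕ, (2 : ℝ) ^ n ≤ ‖(w : ℂ)‖ / r ∧
      ‖(w : ℂ)‖ / r < 2 ^ (n + 1) := fun w =>
    exists_nat_pow_near ((one_le_div hr0).2 (hrw w)) one_lt_two
  choose j hj1 hj2 using hex
  set t : ℝ := 2 * 2 ^ (-σ) with ht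
  have ht0 : 0 ≤ t := by positivity
  have ht1 : t < 1 := by
    have : t = 2 ^ (1 - σ) := by
      rw [ht, sub_eq_add_neg, Real.rpow_add two_pos, Real.rpow_one]
    rw [this]
    exact Real.rpow_lt_one_of_one_lt_of_neg one_lt_two (by linarith)
  set C : ℝ := 8 * A * r * r ^ (-σ) with hC
  have hC0 : 0 ≤ C := by positivity
  refine summable_of_sum_le (c := C * ∑' n : ℕ, t ^ n) (fun w => by positivity) fun S => ?_
  classical
  rw [← Finset.sum_fiberwise_of_maps_to (t := S.image j)
    (fun w hw => Finset.mem_image_of_mem j hw), ← tsum_mul_left]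
  refine le_trans (Finset.sum_le_sum fun n _ => ?_)
    (((summable_geometric_of_lt_one ht0 ht1).mul_left C).sum_le_tsum (S.image j)
      fun n _ => by positivity)
  have hρ : 0 < r * 2 ^ n := by positivity
  have hcount : ∑ w ∈ S with j w = n, (analyticOrderNatAt f w : ℝ) ≤
      4 * A * (r * 2 ^ (n + 1)) := by
    have h := sum_analyticOrderNatAt_le hf h0 hA hb (R := r * 2 ^ (n + 1)) (by positivity)
      ((S.filter fun w => j w = n).map (Function.Embedding.subtype _)) ?_ ?_
    · rwa [Finset.sum_map] at h
    · intro w hw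
      obtain ⟨v, -, rfl⟩ := Finset.mem_map.1 hw
      exact v.2
    · intro w hw
      obtain ⟨v, hv, rfl⟩ := Finset.mem_map.1 hw
      have h2 := hj2 v
      rw [(Finset.mem_filter.1 hv).2, div_lt_iff₀ hr0, mul_comm] at h2
      exact h2.le
  calc ∑ w ∈ S with j w = n, (analyticOrderNatAt f w : ℝ) * ‖(w : ℂ)‖ ^ (-σ)
      ≤ ∑ w ∈ S with j w = n, (analyticOrderNatAt f w : ℝ) * (r * 2 ^ n) ^ (-σ) := by
        refine Finset.sum_le_sum fun w hw => mul_le_mul_of_nonneg_left ?_ (by positivity)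
        refine Real.rpow_le_rpow_of_nonpos hρ ?_ (by linarith)
        have h1 := hj1 w
        rwa [(Finset.mem_filter.1 hw).2, le_div_iff₀ hr0, mul_comm] at h1
    _ = (∑ w ∈ S with j w = n, (analyticOrderNatAt f w : ℝ)) * (r * 2 ^ n) ^ (-σ) := by
        rw [Finset.sum_mul]
    _ ≤ 4 * A * (r * 2 ^ (n + 1)) * (r * 2 ^ n) ^ (-σ) := by gcongr
    _ = C * t ^ n := by
        rw [Real.mul_rpow hr0.le (by positivity), ← Real.rpow_natCast_mul two_pos.le,
          mul_comm (n : ℝ), Real.rpow_mul_natCast two_pos.le, hC, ht, mul_pow]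
        ring

/-! ### The Taylor coefficients of the logarithmic derivative -/

/-- A zero-free function on a disc has a holomorphic logarithm there, whose Taylor coefficients
at the centre are controlled by the Borel–Carathéodory theorem and Cauchy's estimates. -/
theorem norm_iteratedDeriv_logDeriv_le {g : ℂ → ℂ} {M R : ℝ} (hM : 0 < M) (hR : 0 < R)
    (hg : DifferentiableOn ℂ g (Metric.ball 0 R)) (hg0 : g 0 = 1)
    (hne : ∀ z ∈ Metric.ball (0 : ℂ) R, g z ≠ 0)
    (hb : ∀ z ∈ Metric.ball (0 : ℂ) R, ‖g z‖ ≤ Real.exp M) (k : ℕ) :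
    ‖iteratedDeriv k (logDeriv g) 0‖ ≤ (k + 1).factorial * (2 * M) / (R / 2) ^ (k + 1) := by
  have hd : DifferentiableOn ℂ (logDeriv g) (Metric.ball 0 R) :=
    (hg.deriv Metric.isOpen_ball).div hg hne
  obtain ⟨L, hL0, hL⟩ := hd.isExactOn_ball.with_val_at 0 0
  have h0mem : (0 : ℂ) ∈ Metric.ball (0 : ℂ) R := Metric.mem_ball_self hR
  have hLd : DifferentiableOn ℂ L (Metric.ball 0 R) := fun z hz =>
    (hL z hz).differentiableAt.differentiableWithinAt
  -- `g * exp (-L)` has derivative zero on the disc.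
  have hexp : ∀ z ∈ Metric.ball (0 : ℂ) R, g z = Complex.exp (L z) := by
    intro z hz
    have hderiv : ∀ x ∈ Metric.ball (0 : ℂ) R,
        HasDerivAt (fun y => g y * Complex.exp (-L y)) 0 x := by
      intro x hx
      have h1 := ((hg x hx).differentiableAt (Metric.isOpen_ball.mem_nhds hx)).hasDerivAt.mul
        (hL x hx).neg.cexp
      have h2 := hne x hx
      refine h1.congr_deriv ?_
      rw [logDeriv_apply]
      field_simp
      ring
    have hconst := Metric.isOpen_ball.is_const_of_deriv_eq_zero
      (convex_ball (0 : ℂ) R).isPreconnected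
      (fun x hx => (hderiv x hx).differentiableAt.differentiableWithinAt)
      (fun x hx => (hderiv x hx).deriv) hz h0mem
    simp only [hg0, hL0, neg_zero, Complex.exp_zero, mul_one] at hconst
    rw [Complex.exp_neg] at hconst
    exact eq_of_mul_inv_eq_one hconst
  have hre : Set.MapsTo L (Metric.ball 0 R) {z | z.re ≤ M} := fun z hz => by
    have h := hb z hz
    rwa [hexp z hz, Complex.norm_exp, Real.exp_le_exp] at h
  have hR2 : R / 2 < R := by linarith
  have hLb : ∀ z ∈ Metric.sphere (0 : ℂ) (R / 2), ‖L z‖ ≤ 2 * M := by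
    intro z hz
    rw [mem_sphere_zero_iff_norm] at hz
    have h := Complex.borelCaratheodory_zero hM hLd hre hR (z := z)
      (by rw [mem_ball_zero_iff, hz]; exact hR2) hL0
    rw [hz] at h
    convert h using 1
    field_simp
    ring
  have hcont : DiffContOnCl ℂ L (Metric.ball 0 (R / 2)) :=
    (hLd.mono (Metric.closedBall_subset_ball hR2)).diffContOnCl_ball subset_rfl
  have heq : deriv L =ᶠ[nhds 0] logDeriv g := by
    filter_upwards [Metric.isOpen_ball.mem_nhds h0mem] with z hz using (hL z hz).deriv
  rw [← heq.iteratedDeriv_eq, ← iteratedDeriv_succ']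
  exact Complex.norm_iteratedDeriv_le_of_forall_mem_sphere_norm_le (k + 1) (by positivity) hcont hLb

theorem logDeriv_one_sub_div {w : ℂ} (hw : w ≠ 0) (z : ℂ) :
    logDeriv (fun y : ℂ => 1 - y / w) z = (z - w)⁻¹ := by
  have h : HasDerivAt (fun y : ℂ => 1 - y / w) (-(1 / w)) z :=
    ((hasDerivAt_id z).div_const w).const_sub 1
  rw [logDeriv_apply, h.deriv]
  by_cases hz : z = w
  · subst hz
    simp [hw]
  · have : w - z ≠ 0 := sub_ne_zero.2 (Ne.symm hz)
    have : z - w ≠ 0 := sub_ne_zero.2 hz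
    rw [one_sub_div hw]
    field_simp
    ring

theorem iteratedDeriv_inv_sub_zero (k : ℕ) (w : ℂ) :
    iteratedDeriv k (fun z : ℂ => (z - w)⁻¹) 0 = -(k.factorial * (1 / w ^ (k + 1))) := by
  have h := congrFun (iter_deriv_inv_linear_sub k (1 : ℂ) w) 0
  simp only [one_mul, one_pow, mul_one, zero_sub] at h
  rw [iteratedDeriv_eq_iterate, h]
  have h1 : (-1 - (k : ℤ)) = -((k + 1 : ℕ) : ℤ) := by push_cast; ring
  rw [h1, zpow_neg, zpow_natCast, neg_pow w, mul_inv, pow_succ (-1 : ℂ)]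
  have h2 : ((-1 : ℂ) ^ k) * ((-1) ^ k)⁻¹ = 1 := mul_inv_cancel₀ (pow_ne_zero _ (by norm_num))
  rw [mul_inv, one_div]
  linear_combination (-(k.factorial : ℂ) * (w ^ (k + 1))⁻¹) * h2

theorem iteratedDeriv_logDeriv_prod_mul {f g : ℂ → ℂ} (hg : Differentiable ℂ g) (hg0 : g 0 ≠ 0)
    {S : Finset ℂ} (hS : ∀ w ∈ S, w ≠ 0) {m : ℂ → ℕ}
    (hfg : ∀ z, f z = (∏ w ∈ S, (1 - z / w) ^ m w) * g z) (k : ℕ) :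
    iteratedDeriv k (logDeriv f) 0 = iteratedDeriv k (logDeriv g) 0 -
      k.factorial * ∑ w ∈ S, (m w : ℂ) * (1 / w ^ (k + 1)) := by
  have hlog : logDeriv f =ᶠ[nhds 0]
      fun z => (∑ w ∈ S, (m w : ℂ) * (z - w)⁻¹) + logDeriv g z := by
    have hU : ∀ᶠ z in nhds (0 : ℂ), ∀ w ∈ S, z ≠ w :=
      (Filter.eventually_all_finset S).2 fun w hw => isOpen_ne.mem_nhds (hS w hw).symm
    filter_upwards [hU, hg.continuous.continuousAt.eventually_ne hg0] with z hz hgz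
    have hfac : ∀ w ∈ S, (1 - z / w) ^ m w ≠ 0 := fun w hw => pow_ne_zero _ <| by
      rw [sub_ne_zero, ne_comm, Ne, div_eq_one_iff_eq (hS w hw)]
      exact hz w hw
    rw [show f = fun z => (∏ w ∈ S, (1 - z / w) ^ m w) * g z from funext hfg,
      logDeriv_mul z (Finset.prod_ne_zero_iff.2 hfac) hgz (by fun_prop) (hg z),
      logDeriv_prod hfac fun w _ => by fun_prop]
    congr 1
    refine Finset.sum_congr rfl fun w hw => ?_
    rw [logDeriv_fun_pow (f := fun y => 1 - y / w) (by fun_prop),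
      logDeriv_one_sub_div (hS w hw)]
  have hinv : ∀ w ∈ S, ContDiffAt ℂ k (fun z : ℂ => (z - w)⁻¹) 0 := fun w hw =>
    (contDiffAt_id.sub contDiffAt_const).inv (by simpa using hS w hw)
  have hsum : ∀ w ∈ S, ContDiffAt ℂ k (fun z : ℂ => (m w : ℂ) * (z - w)⁻¹) 0 := fun w hw =>
    contDiffAt_const.mul (hinv w hw)
  have hgc : ContDiffAt ℂ k (logDeriv g) 0 :=
    ((hg.analyticAt 0).deriv.div (hg.analyticAt 0) hg0).contDiffAt
  rw [hlog.iteratedDeriv_eq, iteratedDeriv_fun_add (ContDiffAt.sum hsum) hgc,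
    iteratedDeriv_fun_sum hsum, Finset.mul_sum, sub_eq_add_neg, add_comm, ← Finset.sum_neg_distrib]
  congr 1
  refine Finset.sum_congr rfl fun w hw => ?_
  rw [iteratedDeriv_const_mul_field, iteratedDeriv_inv_sub_zero]
  ring

/-- After division by its zeros of norm at most `R`, a function of exponential type `A` is
bounded by `exp (2 * A * R)` and zero-free on the disc of radius `R`; hence the power sum over
these zeros approximates the Taylor coefficient of the logarithmic derivative. -/
theorem norm_iteratedDeriv_logDeriv_add_sum_le {f : ℂ → ℂ} {A R : ℝ} (hf : Differentiable ℂ f)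
    (h0 : f 0 = 1) (hA : 0 < A) (hb : ∀ z, ‖f z‖ ≤ Real.exp (A * ‖z‖)) (hR : 0 < R)
    {S : Finset ℂ} (hS : ∀ w, w ∈ S ↔ f w = 0 ∧ ‖w‖ ≤ R) (k : ℕ) :
    ‖iteratedDeriv k (logDeriv f) 0 + k.factorial *
        ∑ w ∈ S, (analyticOrderNatAt f w : ℂ) * (1 / w ^ (k + 1))‖ ≤
      ((k + 1).factorial * (4 * A) * 2 ^ (k + 1)) / R ^ k := by
  have hS0 : ∀ w ∈ S, w ≠ 0 := by
    rintro w hw rfl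
    simpa [h0] using ((hS 0).1 hw).1
  obtain ⟨g, hg, hgS, hfg⟩ := exists_differentiable_eq_prod_mul hf (by simp [h0]) S hS0
  have hg0 : g 0 = 1 := by simpa [h0] using (hfg 0).symm
  rw [iteratedDeriv_logDeriv_prod_mul hg (by simp [hg0]) hS0 hfg k, sub_add_cancel]
  refine (norm_iteratedDeriv_logDeriv_le (M := 2 * A * R) (by positivity) hR
    hg.differentiableOn hg0 (fun z hz h => ?_) (fun z hz => ?_) k).trans_eq ?_
  · refine hgS z ((hS z).2 ⟨by rw [hfg, h, mul_zero], ?_⟩) h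
    exact (mem_ball_zero_iff.1 hz).le
  · have h := norm_quotient_mul_pow_le hg hb one_pos hR hS0 (fun w hw => ((hS w).1 hw).2) hfg
      (z := z) (by linarith [mem_ball_zero_iff.1 hz])
    rw [one_pow, mul_one] at h
    refine h.trans_eq ?_
    ring_nf
  · rw [div_pow, pow_succ R]
    field_simp
    ring

/-- For `k ≥ 1` the `k`-th Taylor coefficient at `0` of `f' / f` is `-∑ 1 / w ^ (k + 1)`, the sum
running over the zeros of `f` with multiplicity. -/
theorem hasSum_one_div_pow_zeros {f : ℂ → ℂ} {A : ℝ} (hf : Differentiable ℂ f)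
    (h0 : f 0 = 1) (hA : 0 < A) (hb : ∀ z, ‖f z‖ ≤ Real.exp (A * ‖z‖)) {k : ℕ} (hk : k ≠ 0) :
    HasSum (fun w : {w : ℂ | f w = 0} =>
        (analyticOrderNatAt f w : ℂ) * (1 / (w : ℂ) ^ (k + 1)))
      (-(iteratedDeriv k (logDeriv f) 0 / k.factorial)) := by
  have hk1 : (1 : ℝ) < (k : ℝ) + 1 := by
    have : (0 : ℝ) < k := by exact_mod_cast Nat.pos_of_ne_zero hk
    linarith
  have hsum : Summable (fun w : {w : ℂ | f w = 0} =>
      (analyticOrderNatAt f w : ℂ) * (1 / (w : ℂ) ^ (k + 1))) := by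
    refine Summable.of_norm ((summable_analyticOrderNatAt_mul_norm_rpow hf h0 hA hb hk1).congr
      fun w => ?_)
    rw [norm_mul, Complex.norm_natCast, norm_div, norm_one, norm_pow, one_div,
      Real.rpow_neg (norm_nonneg _)]
    norm_cast
  have hfin : ∀ n : ℕ, {w : {w : ℂ | f w = 0} | ‖(w : ℂ)‖ ≤ n}.Finite := fun n =>
    Set.Finite.of_finite_image ((finite_zeros_norm_le hf h0 hA hb n).subset (by
      rintro _ ⟨w, hw, rfl⟩
      exact ⟨w.2, hw⟩)) Subtype.val_injective.injOn
  set T : ℕ → Finset {w : ℂ | f w = 0} := fun n => (hfin n).toFinset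
  have hmem : ∀ n w, w ∈ T n ↔ ‖(w : ℂ)‖ ≤ n := fun n w =>
    (hfin n).mem_toFinset.trans Iff.rfl
  have hTt : Filter.Tendsto T Filter.atTop Filter.atTop := by
    refine Filter.tendsto_atTop_finset_of_monotone (fun n n' hnn w hw => ?_) fun w => ?_
    · rw [hmem] at hw ⊢
      exact le_trans hw (Nat.cast_le.2 hnn)
    · obtain ⟨n, hn⟩ := exists_nat_ge ‖(w : ℂ)‖
      exact ⟨n, (hmem n w).2 hn⟩
  have hlim := hsum.hasSum.comp hTt
  have hkf : (k.factorial : ℂ) ≠ 0 := by exact_mod_cast k.factorial_ne_zero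
  set c := iteratedDeriv k (logDeriv f) 0
  have hzero : Filter.Tendsto (fun n : ℕ => c + k.factorial *
      ∑ w ∈ T n, (analyticOrderNatAt f w : ℂ) * (1 / (w : ℂ) ^ (k + 1)))
      Filter.atTop (nhds 0) := by
    refine squeeze_zero_norm' ?_ ((tendsto_const_div_pow
      ((k + 1).factorial * (4 * A) * 2 ^ (k + 1)) k hk).comp tendsto_natCast_atTop_atTop)
    filter_upwards [Filter.eventually_gt_atTop 0] with n hn
    have h := norm_iteratedDeriv_logDeriv_add_sum_le hf h0 hA hb (R := n) (by exact_mod_cast hn)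
      (S := (T n).map (Function.Embedding.subtype _)) (fun w => ?_) k
    · rwa [Finset.sum_map] at h
    · rw [Finset.mem_map]
      constructor
      · rintro ⟨v, hv, rfl⟩
        exact ⟨v.2, (hmem n v).1 hv⟩
      · rintro ⟨hw, hwn⟩
        exact ⟨⟨w, hw⟩, (hmem n _).2 hwn, rfl⟩
  have huniq := tendsto_nhds_unique hzero ((hlim.const_mul (k.factorial : ℂ)).const_add c)
  refine hsum.hasSum_iff.2 ?_
  rw [← neg_div, eq_div_iff hkf]
  linear_combination -huniq

/-- The Taylor series of `f' / f` at `0` converges in the largest disc without zeros of `f`. -/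
theorem hasSum_logDeriv {f : ℂ → ℂ} (hf : Differentiable ℂ f) {z : ℂ}
    (hz : ∀ w, f w = 0 → ‖z‖ < ‖w‖) :
    HasSum (fun n : ℕ => iteratedDeriv n (logDeriv f) 0 / n.factorial * z ^ n)
      (logDeriv f z) := by
  -- The closed disc of radius `‖z‖` is compact and avoids the closed set of zeros.
  have hopen : IsOpen {w : ℂ | f w ≠ 0} := isOpen_ne_fun hf.continuous continuous_const
  obtain ⟨δ, hδ, hsub⟩ := (isCompact_closedBall (0 : ℂ) ‖z‖).exists_thickening_subset_open hopen
    fun w hw h => absurd (hz w h) (not_lt.2 (mem_closedBall_zero_iff.1 hw))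
  rw [thickening_closedBall hδ (norm_nonneg z)] at hsub
  have hd : DifferentiableOn ℂ (logDeriv f) (Metric.ball 0 (δ + ‖z‖)) :=
    (hf.differentiableOn.deriv Metric.isOpen_ball).div hf.differentiableOn fun w hw => hsub hw
  have h := Complex.hasSum_taylorSeries_on_ball hd (z := z)
    (by rw [mem_ball_zero_iff]; linarith)
  refine h.congr_fun fun n => ?_
  simp only [sub_zero, smul_eq_mul]
  ring

/-! ### Exponential generating functions with bounded coefficients -/

theorem summable_mul_pow_div_factorial {c : ℕ → ℂ} (hc : ∀ k, ‖c k‖ ≤ 1) (z : ℂ) :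
    Summable fun k : ℕ => c k * (z ^ k / (k.factorial : ℂ)) := by
  refine Summable.of_norm_bounded (Real.summable_pow_div_factorial ‖z‖) fun k => ?_
  rw [norm_mul, norm_div, norm_pow, Complex.norm_natCast]
  exact mul_le_of_le_one_left (by positivity) (hc k)

theorem norm_tsum_mul_pow_div_factorial_le {c : ℕ → ℂ} (hc : ∀ k, ‖c k‖ ≤ 1) (z : ℂ) :
    ‖∑' k : ℕ, c k * (z ^ k / (k.factorial : ℂ))‖ ≤ Real.exp ‖z‖ := by
  rw [Real.exp_eq_exp_ℝ]
  refine tsum_of_norm_bounded (NormedSpace.expSeries_div_hasSum_exp ‖z‖) fun k => ?_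
  rw [norm_mul, norm_div, norm_pow, Complex.norm_natCast]
  exact mul_le_of_le_one_left (by positivity) (hc k)

theorem hasDerivAt_tsum_mul_pow_div_factorial {c : ℕ → ℂ} (hc : ∀ k, ‖c k‖ ≤ 1) (z : ℂ) :
    HasDerivAt (fun y : ℂ => ∑' k : ℕ, c k * (y ^ k / (k.factorial : ℂ)))
      (∑' k : ℕ, c (k + 1) * (z ^ k / (k.factorial : ℂ))) z := by
  have hzero : (fun y : ℂ => ∑' k : ℕ, c k * (y ^ k / (k.factorial : ℂ))) =
      fun y => c 0 + ∑' k : ℕ, c (k + 1) * (y ^ (k + 1) / ((k + 1).factorial : ℂ)) := by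
    funext y
    rw [(summable_mul_pow_div_factorial hc y).tsum_eq_zero_add]
    simp
  rw [hzero]
  refine HasDerivAt.const_add _ ?_
  refine hasDerivAt_tsum_of_isPreconnected
    (g' := fun k y => c (k + 1) * (y ^ k / (k.factorial : ℂ)))
    (u := fun k => (‖z‖ + 1) ^ k / (k.factorial : ℝ)) (t := Metric.ball 0 (‖z‖ + 1)) (y₀ := 0)
    (Real.summable_pow_div_factorial _) Metric.isOpen_ball
    (convex_ball _ _).isPreconnected (fun k y _ => ?_) (fun k y hy => ?_)
    (Metric.mem_ball_self (by positivity)) ?_ (by simp)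
  · refine (((hasDerivAt_pow (k + 1) y).div_const _).const_mul (c (k + 1))).congr_deriv ?_
    have : (k.factorial : ℂ) ≠ 0 := by exact_mod_cast k.factorial_ne_zero
    have : (k : ℂ) + 1 ≠ 0 := by exact_mod_cast k.succ_ne_zero
    rw [Nat.factorial_succ]
    push_cast
    field_simp
  · rw [norm_mul, norm_div, norm_pow, Complex.norm_natCast]
    refine (mul_le_of_le_one_left (by positivity) (hc _)).trans ?_
    have := (mem_ball_zero_iff.1 hy).le
    gcongr
  · simp [summable_zero]

/-! ### The Kummer function -/

/-- The coefficients `(a)_k / (a + b)_k` of `Φ_{a,b}` have norm at most one. -/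
theorem norm_ascPochhammer_div_le_one {a b : ℝ} (ha : 0 < a) (hb : 0 ≤ b) (k : ℕ) :
    ‖(ascPochhammer ℂ k).eval (a : ℂ) / (ascPochhammer ℂ k).eval ((a : ℂ) + (b : ℂ))‖ ≤ 1 := by
  induction k with
  | zero => simp
  | succ k ih =>
    rw [ascPochhammer_succ_eval, ascPochhammer_succ_eval, mul_div_mul_comm, norm_mul]
    refine mul_le_one₀ ih (norm_nonneg _) ?_
    have h : ((a : ℂ) + k) / ((a : ℂ) + (b : ℂ) + k) = ((a + k) / (a + b + k) : ℝ) := by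
      push_cast
      rfl
    rw [h, Complex.norm_real, Real.norm_of_nonneg (by positivity)]
    exact div_le_one_of_le₀ (by linarith) (by positivity)

theorem ascPochhammer_eval_ofReal_ne_zero {c : ℝ} (hc : 0 < c) (k : ℕ) :
    (ascPochhammer ℂ k).eval (c : ℂ) ≠ 0 := by
  induction k with
  | zero => simp
  | succ k ih =>
    rw [ascPochhammer_succ_eval]
    refine mul_ne_zero ih ?_
    have : (0 : ℝ) < c + k := by positivity
    exact_mod_cast this.ne'

theorem ascPochhammer_eval_add_one_mul (c : ℂ) (k : ℕ) :
    c * (ascPochhammer ℂ k).eval (c + 1) = (ascPochhammer ℂ k).eval c * (c + k) := by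
  rw [← ascPochhammer_succ_eval, ascPochhammer_succ_left]
  simp

theorem norm_kummerPhi_le {a b : ℝ} (ha : 0 < a) (hb : 0 ≤ b) (z : ℂ) :
    ‖kummerPhi a b z‖ ≤ Real.exp ‖z‖ :=
  norm_tsum_mul_pow_div_factorial_le (norm_ascPochhammer_div_le_one ha hb) z

theorem kummerPhi_zero (a b : ℝ) : kummerPhi a b 0 = 1 := by
  rw [kummerPhi, kummerM, tsum_eq_single 0 fun k hk => by simp [hk]]
  simp

/-- The contiguous relation `Φ_{a,b}' = Φ_{a,b} - b / (a + b) * Φ_{a,b+1}`. -/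
theorem hasDerivAt_kummerPhi {a b : ℝ} (ha : 0 < a) (hb : 0 ≤ b) (z : ℂ) :
    HasDerivAt (kummerPhi a b)
      (kummerPhi a b z - (b : ℂ) / ((a : ℂ) + (b : ℂ)) * kummerPhi a (b + 1) z) z := by
  have hc := norm_ascPochhammer_div_le_one ha hb
  refine (hasDerivAt_tsum_mul_pow_div_factorial hc z).congr_deriv ?_
  have hs := summable_mul_pow_div_factorial hc z
  have hs1 := summable_mul_pow_div_factorial
    (norm_ascPochhammer_div_le_one ha (show 0 ≤ b + 1 by linarith)) z
  rw [kummerPhi, kummerPhi, kummerM, kummerM, ← tsum_mul_left, ← hs.tsum_sub (hs1.mul_left _)]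
  refine tsum_congr fun k => ?_
  have hab : (0 : ℝ) < a + b := by linarith
  have h1 := ascPochhammer_eval_ofReal_ne_zero hab k
  have h2 := ascPochhammer_eval_ofReal_ne_zero (c := a + b + 1) (by linarith) k
  have h3 : (a : ℂ) + b ≠ 0 := by exact_mod_cast hab.ne'
  have h4 : (a : ℂ) + b + k ≠ 0 := by
    have : (0 : ℝ) < a + b + k := by positivity
    exact_mod_cast this.ne'
  have h5 := ascPochhammer_eval_add_one_mul ((a : ℂ) + b) k
  rw [ascPochhammer_succ_eval, ascPochhammer_succ_eval]
  push_cast at h1 h2 ⊢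
  rw [← add_assoc]
  have h6 : (ascPochhammer ℂ k).eval ((a : ℂ) + b + 1) =
      (ascPochhammer ℂ k).eval ((a : ℂ) + b) * (a + b + k) / (a + b) := by
    rw [eq_div_iff h3, ← h5, mul_comm]
  rw [h6]
  field_simp
  ring

theorem mainTheorem3 (a b : ℝ) (ha : 0 < a) (hb : 0 < b) :
    -- the series defining the zeta function converges absolutely for `Re s > 1`
    (∀ s : ℂ, 1 < s.re → Summable (hypergeometricZetaTerm a b s)) ∧
    -- the zeros stay away from the origin
    (∃ r : ℝ, 0 < r ∧ ∀ w ∈ kummerZeros a b, r ≤ ‖w‖) ∧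
    -- the expansion, in the largest disc about the origin that contains no zero
    (∀ z : ℂ, (∀ w ∈ kummerZeros a b, ‖z‖ < ‖w‖) →
      Summable (fun k : ℕ+ => hypergeometricZeta a b (((k : ℕ) : ℂ) + 1) * z ^ (k : ℕ)) ∧
      kummerPhi a (b + 1) z / kummerPhi a b z =
        1 + ((a : ℂ) + (b : ℂ)) / (b : ℂ) *
          ∑' k : ℕ+, hypergeometricZeta a b (((k : ℕ) : ℂ) + 1) * z ^ (k : ℕ)) := by
  have hf : Differentiable ℂ (kummerPhi a b) := fun z =>
    (hasDerivAt_kummerPhi ha hb.le z).differentiableAt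
  have h0 := kummerPhi_zero a b
  have hexp : ∀ z, ‖kummerPhi a b z‖ ≤ Real.exp (1 * ‖z‖) := fun z => by
    rw [one_mul]
    exact norm_kummerPhi_le ha hb.le z
  refine ⟨fun s hs => ?_, ⟨_, by positivity, fun w hw =>
    inv_le_norm_of_apply_eq_zero hf h0 one_pos hexp hw⟩, fun z hz => ?_⟩
  · refine Summable.of_norm_bounded ((summable_analyticOrderNatAt_mul_norm_rpow hf h0 one_pos
      hexp hs).mul_left (Real.exp (Real.pi * |s.im|))) fun w => ?_
    have hw0 : (w : ℂ) ≠ 0 := fun h => by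
      have := w.2
      rw [h] at this
      exact one_ne_zero (h0.symm.trans this)
    have harg : Complex.arg w * s.im ≤ Real.pi * |s.im| := by
      refine (le_abs_self _).trans ?_
      rw [abs_mul]
      exact mul_le_mul_of_nonneg_right (Complex.abs_arg_le_pi _) (abs_nonneg _)
    rw [hypergeometricZetaTerm, norm_mul, Complex.norm_natCast, norm_div, norm_one,
      Complex.norm_cpow_of_ne_zero hw0, one_div_div, div_eq_mul_inv,
      ← Real.rpow_neg (norm_nonneg _), mul_left_comm]
    gcongr
  · have hzeta : ∀ k : ℕ+, hypergeometricZeta a b (((k : ℕ) : ℂ) + 1) =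
        -(iteratedDeriv k (logDeriv (kummerPhi a b)) 0 / (k : ℕ).factorial) := fun k => by
      rw [← (hasSum_one_div_pow_zeros hf h0 one_pos hexp k.ne_zero).tsum_eq]
      refine tsum_congr fun w => ?_
      rw [hypergeometricZetaTerm]
      norm_cast
    have hzf : kummerPhi a b z ≠ 0 := fun h => lt_irrefl _ (hz z h)
    have hT := hasSum_logDeriv hf hz
    have hsum : Summable fun k : ℕ+ =>
        hypergeometricZeta a b (((k : ℕ) : ℂ) + 1) * z ^ (k : ℕ) := by
      refine (hT.summable.comp_injective PNat.coe_injective).neg.congr fun k => ?_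
      rw [hzeta, neg_mul, Function.comp_apply]
    refine ⟨hsum, ?_⟩
    have habR : (0 : ℝ) < a + b := by linarith
    have hab : (a : ℂ) + b ≠ 0 := by exact_mod_cast habR.ne'
    have hbC : (b : ℂ) ≠ 0 := by exact_mod_cast hb.ne'
    have hzero : logDeriv (kummerPhi a b) 0 = 1 - (b : ℂ) / (a + b) := by
      rw [logDeriv_apply, (hasDerivAt_kummerPhi ha hb.le 0).deriv, kummerPhi_zero, kummerPhi_zero]
      ring
    have hlog : logDeriv (kummerPhi a b) z =
        1 - (b : ℂ) / (a + b) * (kummerPhi a (b + 1) z / kummerPhi a b z) := by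
      rw [logDeriv_apply, (hasDerivAt_kummerPhi ha hb.le z).deriv, sub_div, div_self hzf,
        mul_div_assoc]
    have hexpand : logDeriv (kummerPhi a b) z = 1 - (b : ℂ) / (a + b) -
        ∑' k : ℕ+, hypergeometricZeta a b (((k : ℕ) : ℂ) + 1) * z ^ (k : ℕ) := by
      rw [← hT.tsum_eq, ← tsum_zero_pnat_eq_tsum_nat hT.summable, sub_eq_add_neg, ← tsum_neg]
      congr 1
      · simp [hzero]
      · exact tsum_congr fun k => by rw [hzeta, neg_mul, neg_neg]
    rw [hlog] at hexpand
    field_simp at hexpand ⊢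
    linear_combination -hexpand
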